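/- Let $N$ be a real skew-symmetric $n\times n$ matrix that is invertible and has $n$ distinct (complex) eigenvalues (so $n$ is even). Let $\mathrm{Sym}(n)$ be the space of real symmetric $n\times n$ matrices with the inner product $\langle\langle X,Y\rangle\rangle=\operatorname{trace}(XY)$. For integers $k,r$ with $1\le k\le n-1$ and $0\le 2r<k$, let $h_{k,2r}:\mathrm{Sym}(n)\to\mathbb R$ be $\frac1k$ times the trace of the sum of all words of length $k$ in the letters $X$ and $N$ that contain $k-2r$ letters $X$ and $2r$ letters $N$; that is, $h_{k,2r}(X)$ is the coefficient of $\lambda^{2r}$ in $\frac1k\operatorname{trace}(X+\lambda N)^k$. Then the integrals $h_{k,2r}$ ($1\le k\le n-1$, $0\le 2r<k$) are independent: the set of all $X\in\mathrm{Sym}(n)$ at which the gradients $\nabla h_{k,2r}(X)$ with respect to $\langle\langle\cdot,\cdot\rangle\rangle$ are linearly independent over $\mathbb R$ is open and dense in $\mathrm{Sym}(n)$, and its complement has Lebesgue measure zero. -/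

import Mathlib

noncomputable section

/-- The space `Sym(n)` of real symmetric `n × n` matrices, as a subspace of all matrices. -/
def symSubmodule (n : ℕ) : Submodule ℝ (Matrix (Fin n) (Fin n) ℝ) where
  carrier := {X | X.transpose = X}
  add_mem' := by
    intro X Y hX hY
    simp only [Set.mem_ofPred_eq] at hX hY ⊢
    rw [Matrix.transpose_add, hX, hY]
  zero_mem' := Matrix.transpose_zero
  smul_mem' := by
    intro c X hX
    simp only [Set.mem_ofPred_eq] at hX ⊢
    rw [Matrix.transpose_smul, hX]

/-- `Sym(n)`, as a type of its own: it carries the inner product `⟪X, Y⟫ = trace (X Y)` and the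
norm, topology and Lebesgue measure that come from it. -/
def SymMat (n : ℕ) : Type := symSubmodule n

namespace SymMat

variable {n : ℕ}

instance : AddCommGroup (SymMat n) := inferInstanceAs (AddCommGroup (symSubmodule n))

instance : Module ℝ (SymMat n) := inferInstanceAs (Module ℝ (symSubmodule n))

instance : FiniteDimensional ℝ (SymMat n) :=
  inferInstanceAs (FiniteDimensional ℝ (symSubmodule n))

/-- The underlying matrix of an element of `Sym(n)`. -/
def mat (X : SymMat n) : Matrix (Fin n) (Fin n) ℝ := X.1

theorem transpose_mat (X : SymMat n) : X.mat.transpose = X.mat := X.2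

theorem mat_injective : Function.Injective (mat : SymMat n → Matrix (Fin n) (Fin n) ℝ) :=
  Subtype.val_injective

theorem mat_add (X Y : SymMat n) : (X + Y).mat = X.mat + Y.mat := rfl

theorem mat_smul (c : ℝ) (X : SymMat n) : (c • X).mat = c • X.mat := rfl

theorem mat_zero : (0 : SymMat n).mat = 0 := rfl

theorem trace_mat_mul_self (X : SymMat n) :
    Matrix.trace (X.mat * X.mat) = ∑ a, ∑ b, X.mat a b ^ 2 := by
  simp only [Matrix.trace, Matrix.diag_apply, Matrix.mul_apply]
  refine Finset.sum_congr rfl fun a _ => Finset.sum_congr rfl fun b _ => ?_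
  have h : X.mat b a = X.mat a b := by
    have := congrFun (congrFun X.transpose_mat a) b
    simpa [Matrix.transpose_apply] using this
  rw [h, sq]

theorem eq_zero_of_sum_sq_eq_zero (f : Fin n → Fin n → ℝ) (h : ∑ a, ∑ b, f a b ^ 2 = 0)
    (a b : Fin n) : f a b = 0 := by
  have h1 := (Finset.sum_eq_zero_iff_of_nonneg (s := Finset.univ)
    (f := fun a : Fin n => ∑ b, f a b ^ 2)
    (fun a _ => Finset.sum_nonneg fun b _ => sq_nonneg (f a b))).1 h a (Finset.mem_univ a)
  have h2 := (Finset.sum_eq_zero_iff_of_nonneg (s := Finset.univ)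
    (f := fun b : Fin n => f a b ^ 2) (fun b _ => sq_nonneg (f a b))).1 h1 b (Finset.mem_univ b)
  exact pow_eq_zero_iff (two_ne_zero) |>.1 h2

/-- The inner product `⟪X, Y⟫ = trace (X Y)` on `Sym(n)`. -/
@[reducible] def innerCore (n : ℕ) : InnerProductSpace.Core ℝ (SymMat n) where
  inner X Y := Matrix.trace (X.mat * Y.mat)
  conj_inner_symm X Y := by
    simp [Matrix.trace_mul_comm Y.mat X.mat]
  re_inner_nonneg X := by
    have h0 : 0 ≤ ∑ a, ∑ b, X.mat a b ^ 2 :=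
      Finset.sum_nonneg fun a _ => Finset.sum_nonneg fun b _ => sq_nonneg (X.mat a b)
    exact h0.trans_eq (trace_mat_mul_self X).symm
  add_left X Y Z := by
    simp [mat_add, add_mul, Matrix.trace_add]
  smul_left X Y c := by
    simp [mat_smul, Matrix.trace_smul]
  definite X hX := by
    have h0 : ∑ a, ∑ b, X.mat a b ^ 2 = 0 := (trace_mat_mul_self X).symm.trans hX
    apply mat_injective
    ext a b
    exact eq_zero_of_sum_sq_eq_zero (fun a b => X.mat a b) h0 a b

instance : NormedAddCommGroup (SymMat n) := (innerCore n).toNormedAddCommGroup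

instance : InnerProductSpace ℝ (SymMat n) := InnerProductSpace.ofCore (innerCore n).toCore

theorem inner_eq_trace (X Y : SymMat n) : inner ℝ X Y = Matrix.trace (X.mat * Y.mat) := rfl

instance : CompleteSpace (SymMat n) := FiniteDimensional.complete ℝ (SymMat n)

instance : MeasurableSpace (SymMat n) := borel (SymMat n)

instance : BorelSpace (SymMat n) := ⟨rfl⟩

end SymMat

/-- The product of the word of length `k` in the letters `X` and `N` that has the letter `N` in
exactly those places `q` where `w q = true`, and the letter `X` elsewhere. -/
def wordProd {n k : ℕ} (X N : Matrix (Fin n) (Fin n) ℝ) (w : Fin k → Bool) :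
    Matrix (Fin n) (Fin n) ℝ :=
  (List.ofFn fun q => if w q then N else X).prod

/-- The integral `h_{k,m}(X)`: `1/k` times the trace of the sum of all words of length `k` with
`k - m` letters `X` and `m` letters `N`. It is the coefficient of `λ ^ m` in
`(1/k) trace (X + λ N) ^ k`, see `sum_hIntegral`. -/
def hIntegral {n : ℕ} (N : Matrix (Fin n) (Fin n) ℝ) (k m : ℕ) (X : SymMat n) : ℝ :=
  (1 / (k : ℝ)) * Matrix.trace
    (∑ w : Fin k → Bool with (Finset.univ.filter fun q => w q = true).card = m,
      wordProd X.mat N w)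

theorem add_smul_pow_eq_sum_wordProd {n : ℕ} (X N : Matrix (Fin n) (Fin n) ℝ) (t : ℝ) (k : ℕ) :
    (X + t • N) ^ k = ∑ w : Fin k → Bool,
      t ^ (Finset.univ.filter fun q => w q = true).card • wordProd X N w := by
  induction k with
  | zero => simp [wordProd]
  | succ k ih =>
    rw [← (Fin.consEquiv fun _ : Fin (k + 1) => Bool).sum_comp, Fintype.sum_prod_type,
      pow_succ', ih]
    simp only [Fintype.sum_bool, Fin.consEquiv_apply, wordProd, List.ofFn_succ, Fin.cons_zero,
      Fin.cons_succ, List.prod_cons, Fin.card_filter_univ_succ, if_true]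
    rw [add_mul, Finset.mul_sum, Finset.mul_sum, add_comm]
    congr 1
    · refine Finset.sum_congr rfl fun w _ => ?_
      simp [pow_succ', smul_smul, mul_comm]
    · refine Finset.sum_congr rfl fun w _ => ?_
      simp

theorem sum_hIntegral {n : ℕ} (N : Matrix (Fin n) (Fin n) ℝ) (k : ℕ) (X : SymMat n) (t : ℝ) :
    (1 / (k : ℝ)) * Matrix.trace ((X.mat + t • N) ^ k)
      = ∑ m ∈ Finset.range (k + 1), t ^ m * hIntegral N k m X := by
  have hmaps : ∀ w ∈ (Finset.univ : Finset (Fin k → Bool)),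
      (Finset.univ.filter fun q => w q = true).card ∈ Finset.range (k + 1) := by
    intro w _
    rw [Finset.mem_range, Nat.lt_succ_iff]
    simpa using Finset.card_le_univ (Finset.univ.filter fun q => w q = true)
  rw [add_smul_pow_eq_sum_wordProd, ← Finset.sum_fiberwise_of_maps_to hmaps, Matrix.trace_sum,
    Finset.mul_sum]
  refine Finset.sum_congr rfl fun m _ => ?_
  have h : (∑ w : Fin k → Bool with (Finset.univ.filter fun q => w q = true).card = m,
      t ^ (Finset.univ.filter fun q => w q = true).card • wordProd X.mat N w)
      = t ^ m • ∑ w : Fin k → Bool with (Finset.univ.filter fun q => w q = true).card = m,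
        wordProd X.mat N w := by
    rw [Finset.smul_sum]
    refine Finset.sum_congr rfl fun w hw => ?_
    rw [(Finset.mem_filter.mp hw).2]
  rw [h, Matrix.trace_smul, hIntegral, smul_eq_mul]
  ring

/-- The index pairs `(k, r)` of the integrals `h_{k,2r}`: `1 ≤ k ≤ n - 1` and
`0 ≤ r ≤ ⌊(k-1)/2⌋`. -/
abbrev IntegralIndex (n : ℕ) : Type :=
  {p : ℕ × ℕ // 1 ≤ p.1 ∧ p.1 < n ∧ 2 * p.2 < p.1}

/-- The points `X` of `Sym(n)` at which the gradients of all the integrals `h_{k,2r}`, taken with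
respect to the inner product `trace (X Y)`, are linearly independent. -/
def independenceSet {n : ℕ} (N : Matrix (Fin n) (Fin n) ℝ) : Set (SymMat n) :=
  {X | LinearIndependent ℝ fun p : IntegralIndex n => gradient (hIntegral N p.1.1 (2 * p.1.2)) X}

end

/-! The gradient of `hIntegral N k (2 * r)` at `X` is the word sum with `k - 1 - 2r` letters `X` and
`2r` letters `N` (`mat_gradient_hIntegral`), so it suffices that all word sums of length less than
`n` are independent for generic `X`.

One complex symmetric `X` is enough. In an eigenbasis `P` of `N`, ordered along the imaginary axis,
`Pᵀ * P` is antidiagonal, so some symmetric `X` becomes a weighted lower shift `E` while `N` becomes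
diagonal, `D`. Word sums with different numbers of `E` lie on different subdiagonals. On one
subdiagonal, `commutator_wordSum` turns a relation into a shorter one on the next, because only zero
commutes with `D` there; what finally remains is a multiple of a nonzero power of `E`
(`coeff_eq_zero_of_sum_wordSum_eq_zero`).

Independence at one point of a line persists at all but finitely many points. This yields a real
witness, then almost every point on each line parallel to it, and by Fubini full measure, hence
density. Openness is continuity of the gradients. -/

open Matrix

/-! ### Word sums in two noncommuting letters -/

/-- The sum of all words with `e` letters `a` and `f` letters `b`. -/
def wordSum {R : Type*} [Semiring R] (a b : R) : ℕ → ℕ → R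
  | 0, f => b ^ f
  | e + 1, 0 => a ^ (e + 1)
  | e + 1, f + 1 => a * wordSum a b e (f + 1) + b * wordSum a b (e + 1) f

section WordSum

variable {R S : Type*} [Semiring R] [Semiring S] (a b : R)

theorem wordSum_zero_left (f : ℕ) : wordSum a b 0 f = b ^ f := by rw [wordSum]

theorem wordSum_zero_right (e : ℕ) : wordSum a b e 0 = a ^ e := by
  cases e <;> simp [wordSum]

theorem wordSum_succ_succ (e f : ℕ) :
    wordSum a b (e + 1) (f + 1) = a * wordSum a b e (f + 1) + b * wordSum a b (e + 1) f := by
  rw [wordSum]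

/-- Splits words at the last letter, whereas the definition splits at the first. -/
theorem wordSum_succ_succ' (e f : ℕ) :
    wordSum a b (e + 1) (f + 1) = wordSum a b e (f + 1) * a + wordSum a b (e + 1) f * b := by
  induction e generalizing f with
  | zero =>
    induction f with
    | zero => simp [wordSum, add_comm]
    | succ f ih =>
      conv_lhs => rw [wordSum_succ_succ, ih]
      conv_rhs => rw [wordSum_succ_succ]
      simp only [wordSum_zero_left, mul_add, add_mul, mul_assoc]
      simp only [← mul_assoc, ← pow_succ, ← pow_succ']
      simp only [mul_assoc]
      abel
  | succ e ihe =>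
    induction f with
    | zero =>
      conv_lhs => rw [wordSum_succ_succ, ihe]
      conv_rhs => rw [wordSum_succ_succ]
      simp only [wordSum_zero_right, mul_add, add_mul, mul_assoc]
      simp only [← mul_assoc, ← pow_succ, ← pow_succ']
      simp only [mul_assoc]
      abel
    | succ f ihf =>
      conv_lhs => rw [wordSum_succ_succ, ihe, ihf]
      conv_rhs => rw [wordSum_succ_succ a b e (f + 1), wordSum_succ_succ a b (e + 1) f]
      simp only [mul_add, add_mul, mul_assoc]
      abel

theorem map_wordSum {F : Type*} [FunLike F R S] [RingHomClass F R S] (φ : F) (e f : ℕ) :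
    φ (wordSum a b e f) = wordSum (φ a) (φ b) e f := by
  fun_induction wordSum a b e f with
  | case1 => simp [wordSum]
  | case2 => simp [wordSum]
  | case3 e f h1 h2 => simp [wordSum, h1, h2]

theorem wordSum_smul_left {K : Type*} [CommSemiring K] [Algebra K R] (c : K) (e f : ℕ) :
    wordSum (c • a) b e f = c ^ e • wordSum a b e f := by
  fun_induction wordSum a b e f with
  | case1 => simp [wordSum]
  | case2 => simp [wordSum, smul_pow]
  | case3 e f h1 h2 =>
    rw [wordSum_succ_succ, h1, h2]
    simp [pow_succ, smul_smul]

theorem add_smul_pow_eq_sum_wordSum {K : Type*} [CommSemiring K] [Algebra K R] (t : K) (k : ℕ) :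
    (a + t • b) ^ k
      = ∑ p ∈ Finset.HasAntidiagonal.antidiagonal k, t ^ p.2 • wordSum a b p.1 p.2 := by
  induction k with
  | zero => simp [wordSum]
  | succ k ih =>
    rw [pow_succ', ih]
    cases k with
    | zero => simp [Finset.Nat.antidiagonal_succ, wordSum, add_comm]
    | succ k =>
      rw [add_mul]
      nth_rw 1 [Finset.Nat.sum_antidiagonal_succ']
      rw [Finset.Nat.sum_antidiagonal_succ, Finset.Nat.sum_antidiagonal_succ,
        Finset.Nat.sum_antidiagonal_succ']
      simp only [wordSum_succ_succ, wordSum_zero_left, wordSum_zero_right, mul_add, smul_add,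
        Finset.mul_sum, Finset.sum_add_distrib, mul_smul_comm, smul_mul_assoc, pow_succ',
        pow_zero, one_smul, smul_smul, mul_comm _ t]
      abel

/-- Transposition reverses words, which permutes the summands, and each `N` contributes a sign. -/
theorem transpose_wordSum {n K : Type*} [Fintype n] [DecidableEq n] [CommRing K]
    {X N : Matrix n n K} (hX : Xᵀ = X) (hN : Nᵀ = -N) (e f : ℕ) :
    (wordSum X N e f)ᵀ = (-1) ^ f * wordSum X N e f := by
  fun_induction wordSum X N e f with
  | case1 => rw [transpose_pow, hN, neg_pow]
  | case2 => rw [transpose_pow, hX]; simp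
  | case3 e f h1 h2 =>
    rw [transpose_add, transpose_mul, transpose_mul, h1, h2, hX, hN, ← wordSum_succ_succ,
      wordSum_succ_succ', pow_succ]
    simp [mul_add, mul_assoc]

end WordSum

/-- Splitting at the first or at the last letter gives the same word sum. -/
theorem commutator_wordSum {R : Type*} [Ring R] (a b : R) (e f : ℕ) :
    (a * wordSum a b e (f + 1) - wordSum a b e (f + 1) * a)
      + (b * wordSum a b (e + 1) f - wordSum a b (e + 1) f * b) = 0 := by
  rw [sub_add_sub_comm, ← wordSum_succ_succ, ← wordSum_succ_succ', sub_self]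

/-! ### Word sums of a weighted lower shift and a diagonal matrix -/

section LowerShift

variable {n : ℕ} {K : Type*} [Field K]

/-- A matrix is supported on the `d`-th subdiagonal. -/
def SupportedOnSubdiagonal (d : ℕ) (A : Matrix (Fin n) (Fin n) K) : Prop :=
  ∀ a b : Fin n, (a : ℕ) ≠ b + d → A a b = 0

theorem SupportedOnSubdiagonal.mul {d e : ℕ} {A B : Matrix (Fin n) (Fin n) K}
    (hA : SupportedOnSubdiagonal d A) (hB : SupportedOnSubdiagonal e B) :
    SupportedOnSubdiagonal (d + e) (A * B) := by
  intro a b hab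
  rw [mul_apply]
  refine Finset.sum_eq_zero fun c _ => ?_
  by_cases h : (a : ℕ) = c + d
  · rw [hB c b (by omega), mul_zero]
  · rw [hA a c h, zero_mul]

theorem SupportedOnSubdiagonal.add {d : ℕ} {A B : Matrix (Fin n) (Fin n) K}
    (hA : SupportedOnSubdiagonal d A) (hB : SupportedOnSubdiagonal d B) :
    SupportedOnSubdiagonal d (A + B) := fun a b hab => by
  rw [Matrix.add_apply, hA a b hab, hB a b hab, add_zero]

theorem supportedOnSubdiagonal_one : SupportedOnSubdiagonal 0 (1 : Matrix (Fin n) (Fin n) K) :=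
  fun a b hab => one_apply_ne fun h => hab (by simp [h])

theorem supportedOnSubdiagonal_diagonal (ν : Fin n → K) :
    SupportedOnSubdiagonal 0 (diagonal ν) :=
  fun a b hab => diagonal_apply_ne ν fun h => hab (by simp [h])

theorem SupportedOnSubdiagonal.pow {d : ℕ} {A : Matrix (Fin n) (Fin n) K}
    (hA : SupportedOnSubdiagonal d A) (k : ℕ) : SupportedOnSubdiagonal (k * d) (A ^ k) := by
  induction k with
  | zero => simpa using supportedOnSubdiagonal_one
  | succ k ih => rw [pow_succ, Nat.succ_mul]; exact ih.mul hA

variable {E : Matrix (Fin n) (Fin n) K} {ν : Fin n → K}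

theorem SupportedOnSubdiagonal.wordSum {D : Matrix (Fin n) (Fin n) K}
    (hE : SupportedOnSubdiagonal 1 E) (hD : SupportedOnSubdiagonal 0 D) (e f : ℕ) :
    SupportedOnSubdiagonal e (wordSum E D e f) := by
  fun_induction _root_.wordSum E D e f with
  | case1 f => simpa using hD.pow f
  | case2 e => simpa using hE.pow (e + 1)
  | case3 e f h1 h2 =>
    refine SupportedOnSubdiagonal.add ?_ ?_
    · have := hE.mul h1
      rwa [add_comm 1 e] at this
    · simpa using hD.mul h2

/-- A power of a weighted lower shift has a nonzero entry in its first column. -/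
theorem pow_lowerShift_ne_zero (hE : SupportedOnSubdiagonal 1 E)
    (hE1 : ∀ a b : Fin n, (a : ℕ) = b + 1 → E a b ≠ 0) {k : ℕ} (hk : k < n) : E ^ k ≠ 0 := by
  suffices h : (E ^ k) ⟨k, hk⟩ ⟨0, by omega⟩ ≠ 0 from fun h0 => h (by rw [h0]; rfl)
  induction k with
  | zero => simp
  | succ k ih =>
    rw [pow_succ', mul_apply, Finset.sum_eq_single ⟨k, by omega⟩]
    · exact mul_ne_zero (hE1 _ _ rfl) (ih (by omega))
    · intro c _ hc
      rw [hE _ c (by simpa [Fin.ext_iff, eq_comm] using hc), zero_mul]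
    · simp

/-- A matrix off the diagonal that commutes with a diagonal matrix with distinct entries is zero. -/
theorem eq_zero_of_commute_diagonal (hν : Function.Injective ν) {d : ℕ}
    {F : Matrix (Fin n) (Fin n) K} (hF : SupportedOnSubdiagonal (d + 1) F)
    (h : diagonal ν * F - F * diagonal ν = 0) : F = 0 := by
  ext a b
  by_cases hab : (a : ℕ) = b + (d + 1)
  · have h1 := congrFun (congrFun h a) b
    rw [Matrix.sub_apply, diagonal_mul, mul_diagonal, mul_comm (F a b), ← sub_mul] at h1
    refine (mul_eq_zero.1 h1).resolve_left (sub_ne_zero.2 fun h2 => ?_)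
    have := hν h2
    omega
  · exact hF a b hab

theorem coeff_eq_zero_of_sum_wordSum_eq_zero (hE : SupportedOnSubdiagonal 1 E)
    (hE1 : ∀ a b : Fin n, (a : ℕ) = b + 1 → E a b ≠ 0) (hν : Function.Injective ν) (d M : ℕ)
    (hM : d + M < n + 1) (c : ℕ → K)
    (h : ∑ f ∈ Finset.range M, c f • wordSum E (diagonal ν) d f = 0) : ∀ f < M, c f = 0 := by
  induction M with
  | zero => simp
  | succ M ih =>
    -- The relation after `u` commutators with `E`: one more `E` and one fewer diagonal letter each
    -- time.
    have key : ∀ u ≤ M, ∑ g ∈ Finset.range (M + 1 - u),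
        c (g + u) • wordSum E (diagonal ν) (d + u) g = 0 := by
      intro u
      induction u with
      | zero => intro _; simpa using h
      | succ u ihu =>
        intro hu
        have h0 := ihu (by omega)
        rw [show M + 1 - u = (M - u) + 1 by omega, Finset.sum_range_succ'] at h0
        rw [show M + 1 - (u + 1) = M - u by omega]
        refine eq_zero_of_commute_diagonal hν (d := d + u) ?_ ?_
        · intro a b hab
          rw [Matrix.sum_apply]
          refine Finset.sum_eq_zero fun g _ => ?_
          rw [Matrix.smul_apply, hE.wordSum (supportedOnSubdiagonal_diagonal ν) (d + (u + 1)) g a b hab,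
            smul_zero]
        -- The term `g = 0` is a power of `E`, so it drops out of the commutator; the others become
        -- commutators with `diagonal ν`.
        · have h1 := congrArg (fun F => E * F - F * E) h0
          simp only [mul_zero, zero_mul, sub_zero, mul_add, add_mul, wordSum_zero_right,
            mul_smul_comm, smul_mul_assoc, ← pow_succ, ← pow_succ'] at h1
          rw [add_sub_add_right_eq_sub] at h1
          refine (zero_add _).symm.trans ((congrArg (· + _) h1).symm.trans ?_)
          simp only [Finset.mul_sum, Finset.sum_mul, ← Finset.sum_sub_distrib,
            ← Finset.sum_add_distrib, mul_smul_comm, smul_mul_assoc, ← smul_sub]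
          refine Finset.sum_eq_zero fun g _ => ?_
          rw [show g + 1 + u = g + (u + 1) by ring, ← smul_add, ← add_assoc d u 1,
            commutator_wordSum, smul_zero]
    have hcM : c M = 0 := by
      have h1 := key M le_rfl
      rw [show M + 1 - M = 1 by omega, Finset.sum_range_one, zero_add, wordSum_zero_right] at h1
      exact (smul_eq_zero.1 h1).resolve_right (pow_lowerShift_ne_zero hE hE1 (by omega))
    rw [Finset.sum_range_succ, hcM, zero_smul, add_zero] at h
    intro f hf
    rcases Nat.lt_succ_iff_lt_or_eq.1 hf with h1 | rfl
    · exact ih (by omega) h f h1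
    · exact hcM

/-- Pairs of numbers of letters in words of length less than `n`. -/
abbrev WordIndex (n : ℕ) : Type := {p : ℕ × ℕ // p.1 + p.2 < n}

instance (n : ℕ) : Finite (WordIndex n) :=
  Finite.of_injective (β := Fin n × Fin n)
    (fun p => (⟨p.1.1, by have := p.2; omega⟩, ⟨p.1.2, by have := p.2; omega⟩))
    fun p q h => by
      simp only [Prod.mk.injEq, Fin.mk.injEq] at h
      exact Subtype.ext (Prod.ext h.1 h.2)

/-- A relation splits by subdiagonal, that is, by the number of letters `E`. -/
theorem linearIndependent_wordSum_lowerShift (hE : SupportedOnSubdiagonal 1 E)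
    (hE1 : ∀ a b : Fin n, (a : ℕ) = b + 1 → E a b ≠ 0) (hν : Function.Injective ν) :
    LinearIndependent K fun p : WordIndex n => wordSum E (diagonal ν) p.1.1 p.1.2 := by
  have := Fintype.ofFinite (WordIndex n)
  rw [Fintype.linearIndependent_iff]
  intro g hg
  -- The default `0` is never reached, since `f < n - d`.
  have hsum : ∀ d, d < n → ∑ f ∈ Finset.range (n - d),
      (if h : d + f < n then g ⟨(d, f), h⟩ else 0) • wordSum E (diagonal ν) d f = 0 := by
    intro d hd
    have h1 : ∑ f ∈ Finset.range (n - d),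
        (if h : d + f < n then g ⟨(d, f), h⟩ else 0) • wordSum E (diagonal ν) d f
        = ∑ p : WordIndex n with p.1.1 = d, g p • wordSum E (diagonal ν) p.1.1 p.1.2 := by
      refine Finset.sum_bij' (fun f hf => ⟨(d, f), by have := Finset.mem_range.1 hf; omega⟩)
        (fun p _ => p.1.2) ?_ ?_ ?_ ?_ ?_
      · simp
      · intro p hp
        have h2 := p.2
        simp only [Finset.mem_filter] at hp
        rw [Finset.mem_range]
        omega
      · simp
      · intro p hp
        simp only [Finset.mem_filter] at hp
        exact Subtype.ext (Prod.ext hp.2.symm rfl)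
      · intro f hf
        rw [dif_pos]
    rw [h1]
    ext a b
    by_cases hab : (a : ℕ) = b + d
    · have h2 := congrFun (congrFun hg a) b
      rw [← h2, Matrix.sum_apply, Matrix.sum_apply, Finset.sum_filter]
      refine Finset.sum_congr rfl fun p _ => ?_
      split_ifs with hp
      · rfl
      · rw [Matrix.smul_apply, hE.wordSum (supportedOnSubdiagonal_diagonal ν) _ _ a b (by omega),
          smul_zero]
    · rw [Matrix.sum_apply]
      refine Finset.sum_eq_zero fun p hp => ?_
      rw [Matrix.smul_apply, hE.wordSum (supportedOnSubdiagonal_diagonal ν) _ _ a b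
        (by rwa [(Finset.mem_filter.1 hp).2]), smul_zero]
  rintro ⟨⟨d, f⟩, hdf⟩
  have h := coeff_eq_zero_of_sum_wordSum_eq_zero hE hE1 hν d (n - d) (by omega) _
    (hsum d (by omega)) f (by simp at hdf; omega)
  rwa [dif_pos hdf] at h

/-- Linear independence of word sums is invariant under conjugation. -/
theorem linearIndependent_wordSum_of_conj {ι : Type*} {P X N Y D : Matrix (Fin n) (Fin n) K}
    (hP : IsUnit P) (hX : X * P = P * Y) (hN : N * P = P * D) (s : ι → ℕ × ℕ)
    (h : LinearIndependent K fun i => wordSum Y D (s i).1 (s i).2) :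
    LinearIndependent K fun i => wordSum X N (s i).1 (s i).2 := by
  have hw : ∀ e f, wordSum X N e f * P = P * wordSum Y D e f := by
    intro e f
    fun_induction wordSum X N e f with
    | case1 f => rw [wordSum_zero_left]; exact (SemiconjBy.pow_right (a := P) (by exact hN.symm) f).symm
    | case2 e => rw [wordSum_zero_right]; exact (SemiconjBy.pow_right (a := P) (by exact hX.symm) _).symm
    | case3 e f h1 h2 =>
      rw [add_mul, mul_assoc, mul_assoc, h1, h2, ← mul_assoc, ← mul_assoc, hX, hN,
        wordSum_succ_succ, mul_add, mul_assoc, mul_assoc]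
  refine LinearIndependent.of_comp (LinearMap.mulRight K P) ?_
  have h2 := h.map' (LinearMap.mulLeft K P)
    (LinearMap.ker_eq_bot.2 fun A B hAB => hP.mul_left_cancel hAB)
  have h3 : (LinearMap.mulRight K P) ∘ (fun i => wordSum X N (s i).1 (s i).2)
      = (LinearMap.mulLeft K P) ∘ fun i => wordSum Y D (s i).1 (s i).2 := funext fun i => hw _ _
  rwa [h3]

end LowerShift

/-! ### Eigenbases of skew-symmetric matrices and a complex symmetric witness -/

section Skew

variable {n : ℕ} {N : Matrix (Fin n) (Fin n) ℝ}

/-- A real skew-symmetric matrix is diagonalizable over `ℂ` with purely imaginary eigenvalues. -/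
theorem exists_diagonalization_of_skew (hskew : Nᵀ = -N) :
    ∃ (P : Matrix (Fin n) (Fin n) ℂ) (μ : Fin n → ℝ), IsUnit P ∧ Monotone μ ∧
      N.map (algebraMap ℝ ℂ) * P = P * diagonal fun i => Complex.I * μ i := by
  set Nc := N.map (algebraMap ℝ ℂ) with hNc
  -- The spectral theorem applies after multiplication by `-i`.
  have hH : (-Complex.I • Nc).IsHermitian := by
    ext a b
    have h := congrFun (congrFun hskew a) b
    simp only [transpose_apply, Matrix.neg_apply] at h
    simp [hNc, conjTranspose_apply, h]
  set σ := Tuple.sort hH.eigenvalues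
  refine ⟨of fun a b => hH.eigenvectorBasis (σ b) a, fun i => hH.eigenvalues (σ i), ?_,
    Tuple.monotone_sort hH.eigenvalues, ?_⟩
  · have h1 : IsUnit (hH.eigenvectorUnitary : Matrix (Fin n) (Fin n) ℂ) :=
      ⟨Unitary.toUnits hH.eigenvectorUnitary, rfl⟩
    rw [isUnit_iff_isUnit_det] at h1 ⊢
    have h2 : (of fun a b => hH.eigenvectorBasis (σ b) a : Matrix (Fin n) (Fin n) ℂ)
        = (hH.eigenvectorUnitary : Matrix (Fin n) (Fin n) ℂ).submatrix id σ := by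
      ext a b
      simp [IsHermitian.eigenvectorUnitary_apply]
    rw [h2, det_permute']
    refine IsUnit.mul ?_ h1
    rcases Int.units_eq_one_or (Equiv.Perm.sign σ) with h | h <;> simp [h]
  · ext a b
    have h := congrFun (hH.mulVec_eigenvectorBasis (σ b)) a
    rw [mul_diagonal, mul_apply]
    simp only [of_apply]
    generalize (hH.eigenvectorBasis (σ b)).ofLp = v at h ⊢
    generalize hH.eigenvalues (σ b) = c at h ⊢
    simp only [neg_smul, neg_mulVec, smul_mulVec, Pi.neg_apply, Pi.smul_apply, smul_eq_mul,
      Complex.real_smul] at h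
    have h3 : ∑ j, Nc a j * v j = (Nc *ᵥ v) a := rfl
    rw [h3]
    linear_combination Complex.I * h + (Nc *ᵥ v) a * Complex.I_mul_I

theorem injective_of_charpoly_roots_nodup {A P : Matrix (Fin n) (Fin n) ℂ} {ν : Fin n → ℂ}
    (hP : IsUnit P) (hA : A * P = P * diagonal ν) (h : A.charpoly.roots.Nodup) :
    Function.Injective ν := by
  obtain ⟨u, rfl⟩ := hP
  have h1 : A = (u : Matrix (Fin n) (Fin n) ℂ) * diagonal ν * (u : Matrix (Fin n) (Fin n) ℂ)⁻¹ := by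
    rw [← hA, ← coe_units_inv, Units.mul_inv_cancel_right]
  have h2 : ∏ i, (Polynomial.X - Polynomial.C (ν i))
      = ((Finset.univ.val.map ν).map fun a => Polynomial.X - Polynomial.C a).prod := by
    rw [Multiset.map_map]; rfl
  rw [h1, charpoly_units_conj, charpoly_diagonal, h2, Polynomial.roots_multiset_prod_X_sub_C,
    Multiset.nodup_map_iff_inj_on Finset.univ.nodup] at h
  exact fun i j hij => h i (Finset.mem_univ i) j (Finset.mem_univ j) hij

/-- The complex bilinear form is antidiagonal in an eigenbasis of a skew-symmetric matrix whose
eigenvalues are ordered along the imaginary axis. -/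
theorem transpose_mul_self_antidiagonal {A P : Matrix (Fin n) (Fin n) ℂ} {μ : Fin n → ℝ}
    (hA : Aᵀ = -A) (hP : IsUnit P) (hμ : StrictMono μ)
    (hAP : A * P = P * diagonal fun i => Complex.I * μ i) (i j : Fin n) :
    (Pᵀ * P) i j ≠ 0 ↔ j = Fin.rev i := by
  set ν : Fin n → ℂ := fun i => Complex.I * μ i with hν
  set G := Pᵀ * P with hG
  -- `A` is skew for the bilinear form, so eigenvectors pair to zero unless their eigenvalues sum to
  -- zero.
  have hGν : ∀ i j, G i j ≠ 0 → μ j = - μ i := by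
    intro i j hij
    have h1 : diagonal ν * G = - (G * diagonal ν) := by
      have hT : diagonal ν * Pᵀ = -(Pᵀ * A) := by
        have := congrArg transpose hAP
        rw [transpose_mul, transpose_mul, hA, diagonal_transpose, mul_neg] at this
        exact this.symm
      rw [hG, ← mul_assoc, hT, neg_mul, mul_assoc, hAP, mul_assoc]
    have h2 := congrFun (congrFun h1 i) j
    rw [diagonal_mul, Matrix.neg_apply, mul_diagonal] at h2
    have h3 : G i j * (Complex.I * ((μ j + μ i : ℝ) : ℂ)) = 0 := by
      push_cast
      linear_combination h2
    have h4 := (mul_eq_zero.1 ((mul_eq_zero.1 h3).resolve_left hij)).resolve_left Complex.I_ne_zero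
    linarith [Complex.ofReal_eq_zero.1 h4]
  have hrow : ∀ i, ∃ j, G i j ≠ 0 := by
    intro i
    by_contra! h0
    have hGunit : IsUnit G := ((isUnit_transpose P).2 hP).mul hP
    rw [isUnit_iff_isUnit_det, det_eq_zero_of_row_eq_zero i h0] at hGunit
    exact not_isUnit_zero hGunit
  -- No row of the invertible `G` vanishes, so the spectrum is symmetric about `0`; two strictly
  -- increasing enumerations of it agree.
  have hneg : μ = fun i => - μ (Fin.rev i) := by
    refine (StrictMono.range_inj hμ ?_).1 ?_
    · intro i j hij
      exact neg_lt_neg (hμ (Fin.rev_lt_rev.2 hij))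
    · ext x
      constructor
      · rintro ⟨i, rfl⟩
        obtain ⟨j, hj⟩ := hrow i
        exact ⟨Fin.rev j, by simp [hGν i j hj]⟩
      · rintro ⟨i, rfl⟩
        obtain ⟨j, hj⟩ := hrow (Fin.rev i)
        exact ⟨j, hGν _ j hj⟩
  have hrev : ∀ i j, G i j ≠ 0 → j = Fin.rev i := by
    intro i j hij
    apply hμ.injective
    rw [hGν i j hij, congrFun hneg i, neg_neg]
  refine ⟨hrev i j, ?_⟩
  rintro rfl
  obtain ⟨j, hj⟩ := hrow i
  rwa [← hrev i j hj]

theorem exists_symmetric_linearIndependent_wordSum (hskew : Nᵀ = -N)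
    (hdistinct : (N.map (algebraMap ℝ ℂ)).charpoly.roots.Nodup) :
    ∃ X : Matrix (Fin n) (Fin n) ℂ, Xᵀ = X ∧ LinearIndependent ℂ fun p : WordIndex n =>
      wordSum X (N.map (algebraMap ℝ ℂ)) p.1.1 p.1.2 := by
  obtain ⟨P, μ, hP, hμ, hNP⟩ := exists_diagonalization_of_skew hskew
  have hν := injective_of_charpoly_roots_nodup hP hNP hdistinct
  have hμ' : StrictMono μ := hμ.strictMono_of_injective fun i j hij => hν (by simp only [hij])
  have hNT : (N.map (algebraMap ℝ ℂ))ᵀ = -N.map (algebraMap ℝ ℂ) := by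
    rw [← transpose_map, hskew]
    ext
    simp
  have hG := transpose_mul_self_antidiagonal hNT hP hμ' hNP
  -- The antidiagonal proper is `a + b = n - 1`; moving it by one makes the product with `Pᵀ * P` a
  -- lower shift.
  obtain ⟨S, hS⟩ : ∃ S : Matrix (Fin n) (Fin n) ℂ, ∀ a b, S a b = if (a : ℕ) + b = n then 1 else 0 :=
    ⟨of fun a b => if (a : ℕ) + b = n then 1 else 0, fun _ _ => rfl⟩
  have hSG : ∀ a b : Fin n, (S * (Pᵀ * P)) a b
      = if (a : ℕ) = b + 1 then (Pᵀ * P) (Fin.rev b) b else 0 := by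
    intro a b
    rw [mul_apply, Finset.sum_eq_single (Fin.rev b)]
    · rw [hS, ite_mul, one_mul, zero_mul, Fin.val_rev]
      refine if_congr ?_ rfl rfl
      omega
    · intro c _ hc
      by_contra h0
      exact hc (by rw [(hG c b).1 (right_ne_zero_of_mul h0), Fin.rev_rev])
    · simp
  have hST : Sᵀ = S := by
    ext a b
    rw [transpose_apply, hS, hS, add_comm]
  have hXP : P * S * Pᵀ * P = P * (S * (Pᵀ * P)) := by simp only [mul_assoc]
  have hE : SupportedOnSubdiagonal 1 (S * (Pᵀ * P)) := fun a b hab => by rw [hSG, if_neg hab]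
  have hE1 : ∀ a b : Fin n, (a : ℕ) = b + 1 → (S * (Pᵀ * P)) a b ≠ 0 := by
    intro a b hab
    rw [hSG, if_pos hab]
    exact (hG _ _).2 (Fin.rev_rev b).symm
  refine ⟨P * S * Pᵀ, ?_, linearIndependent_wordSum_of_conj hP hXP hNP
    (fun p : WordIndex n => p.1) (linearIndependent_wordSum_lowerShift hE hE1 hν)⟩
  rw [transpose_mul, transpose_mul, transpose_transpose, hST, mul_assoc]

end Skew

/-! ### Persistence of linear independence along a line -/

section PolynomialFamilies

variable {m n ι : Type*} [Fintype m] [Fintype n] [Finite ι] {K : Type*} [Field K]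

/-- A polynomial family of matrices that is linearly independent at one parameter value is linearly
independent at all but finitely many. -/
theorem finite_setOf_not_linearIndependent_eval (v : ι → Matrix m n (Polynomial K)) (t₀ : K)
    (h : LinearIndependent K fun i => (v i).map (Polynomial.eval t₀)) :
    {t : K | ¬ LinearIndependent K fun i => (v i).map (Polynomial.eval t)}.Finite := by
  classical
  have := Fintype.ofFinite ι
  obtain ⟨φ, hφ⟩ := LinearMap.exists_leftInverse_of_injective
    (Fintype.linearCombination K fun i => (v i).map (Polynomial.eval t₀))
    (LinearMap.ker_eq_bot.2 (linearIndependent_iff_injective_fintypeLinearCombination.1 h))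
  -- Coordinates of the family under the left inverse `φ`: the determinant is a polynomial in `t`
  -- with value `1` at `t₀`, and independence holds wherever it is nonzero.
  let Q : Matrix ι ι (Polynomial K) :=
    of fun i j => ∑ a, ∑ b, Polynomial.C (φ (Matrix.single a b 1) j) * v i a b
  have hQ : ∀ t i j, (Q i j).eval t = φ ((v i).map (Polynomial.eval t)) j := by
    intro t i j
    conv_rhs => rw [matrix_eq_sum_single ((v i).map (Polynomial.eval t))]
    simp only [Q, of_apply, Polynomial.eval_finsetSum, Polynomial.eval_mul, Polynomial.eval_C,
      map_sum, Finset.sum_apply, map_apply]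
    refine Finset.sum_congr rfl fun a _ => Finset.sum_congr rfl fun b _ => ?_
    rw [← mul_one ((v i a b).eval t), ← smul_eq_mul _ (1 : K), ← smul_single, map_smul,
      Pi.smul_apply, smul_eq_mul, smul_eq_mul, mul_one, mul_comm]
  have hdet : ∀ t, Q.det.eval t = (of fun i j => φ ((v i).map (Polynomial.eval t)) j).det := by
    intro t
    rw [← Polynomial.coe_evalRingHom, RingHom.map_det]
    congr 1
    ext i j
    exact hQ t i j
  have h0 : Q.det ≠ 0 := by
    intro h0
    have h1 := hdet t₀
    have h2 : (of fun i j => φ ((v i).map (Polynomial.eval t₀)) j) = (1 : Matrix ι ι K) := by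
      ext i j
      have h3 := congrFun (LinearMap.congr_fun hφ (Pi.single i 1)) j
      rw [LinearMap.comp_apply, Fintype.linearCombination_apply_single, one_smul] at h3
      rw [of_apply, h3, LinearMap.id_apply, one_apply, Pi.single_apply]
      simp [eq_comm]
    rw [h0, h2, det_one, Polynomial.eval_zero] at h1
    exact zero_ne_one h1
  refine (Polynomial.finite_setOfPred_isRoot h0).subset fun t ht => ?_
  by_contra hroot
  apply ht
  rw [Set.mem_ofPred_eq, Polynomial.IsRoot, hdet] at hroot
  have h4 := linearIndependent_rows_of_det_ne_zero hroot
  exact h4.of_comp φ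

theorem finite_setOf_not_linearIndependent_wordSum [DecidableEq n] (X Y N : Matrix n n K)
    (s : ι → ℕ × ℕ) (t₀ : K)
    (h : LinearIndependent K fun i => wordSum (X + t₀ • Y) N (s i).1 (s i).2) :
    {t : K | ¬ LinearIndependent K fun i => wordSum (X + t • Y) N (s i).1 (s i).2}.Finite := by
  have hw : ∀ t i, (wordSum (X.map Polynomial.C + (Polynomial.X : Polynomial K) • Y.map Polynomial.C)
      (N.map Polynomial.C) (s i).1 (s i).2).map (Polynomial.eval t)
      = wordSum (X + t • Y) N (s i).1 (s i).2 := by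
    intro t i
    have h1 := map_wordSum (X.map Polynomial.C + (Polynomial.X : Polynomial K) • Y.map Polynomial.C)
      (N.map Polynomial.C) (Polynomial.evalRingHom t).mapMatrix (s i).1 (s i).2
    refine h1.trans ?_
    congr 1
    · ext a b
      simp [mul_comm (Y a b)]
    · ext a b
      simp
  have h2 := finite_setOf_not_linearIndependent_eval (fun i => wordSum (X.map Polynomial.C
    + (Polynomial.X : Polynomial K) • Y.map Polynomial.C) (N.map Polynomial.C) (s i).1 (s i).2) t₀
  simp only [hw] at h2
  exact h2 h

end PolynomialFamilies

/-! ### Gradients of the integrals -/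

section Gradient

variable {n : ℕ} (N : Matrix (Fin n) (Fin n) ℝ)

theorem SymMat.contDiff_mat_apply (a b : Fin n) : ContDiff ℝ 1 fun X : SymMat n => X.mat a b :=
  (LinearMap.toContinuousLinearMap
    ({ toFun := fun X => X.mat a b
       map_add' := fun _ _ => rfl
       map_smul' := fun _ _ => rfl } : SymMat n →ₗ[ℝ] ℝ)).contDiff

theorem contDiff_wordProd_apply {k : ℕ} (w : Fin k → Bool) (a b : Fin n) :
    ContDiff ℝ 1 fun X : SymMat n => wordProd X.mat N w a b := by
  induction k generalizing a b with
  | zero => simpa [wordProd] using contDiff_const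
  | succ k ih =>
    have h : ∀ X : SymMat n, wordProd X.mat N w a b
        = ∑ c, (if w 0 then N else X.mat) a c * wordProd X.mat N (Fin.tail w) c b := by
      intro X
      rw [wordProd, List.ofFn_succ, List.prod_cons, mul_apply]
      rfl
    simp only [h]
    refine ContDiff.sum fun c _ => ContDiff.mul ?_ (ih _ c b)
    split_ifs
    · exact contDiff_const
    · exact SymMat.contDiff_mat_apply a c

theorem contDiff_hIntegral (k m : ℕ) : ContDiff ℝ 1 (hIntegral N k m) := by
  unfold hIntegral
  refine contDiff_const.mul ?_
  simp only [trace, diag_apply, Matrix.sum_apply]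
  exact ContDiff.sum fun a _ => ContDiff.sum fun w _ => contDiff_wordProd_apply N w a a

/-- By cyclicity of the trace, the `e + 1` words with a single `Y` contribute equally. The prefix `A
^ j` carries the induction. -/
theorem trace_pow_mul_wordSum_one (A Y : Matrix (Fin n) (Fin n) ℝ) (j e : ℕ) :
    trace (A ^ j * wordSum A Y e 1) = (e + 1) * trace (A ^ (j + e) * Y) := by
  induction e generalizing j with
  | zero => simp [wordSum_zero_left]
  | succ e ih =>
    rw [wordSum_succ_succ, mul_add, trace_add, ← mul_assoc, ← pow_succ, ih, wordSum_zero_right,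
      ← mul_assoc, trace_mul_comm (A ^ j * Y), ← mul_assoc, ← pow_add, show e + 1 + j = j + (e + 1) by ring,
      show j + 1 + e = j + (e + 1) by ring]
    push_cast
    ring

theorem hasDerivAt_trace_pow (A Y : Matrix (Fin n) (Fin n) ℝ) (k : ℕ) :
    HasDerivAt (fun s : ℝ => trace ((A + s • Y) ^ k)) (k * trace (A ^ (k - 1) * Y)) 0 := by
  simp only [add_smul_pow_eq_sum_wordSum, trace_sum, trace_smul, smul_eq_mul]
  refine (HasDerivAt.fun_sum fun p _ => (hasDerivAt_pow p.2 (0 : ℝ)).mul_const _).congr_deriv ?_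
  cases k with
  | zero => simp
  | succ k =>
    rw [Finset.Nat.sum_antidiagonal_succ', Finset.sum_eq_single (k, 0)]
    · have h := trace_pow_mul_wordSum_one A Y 0 k
      rw [pow_zero, one_mul, zero_add] at h
      simp [h]
    · intro p hp hpk
      have h1 := Finset.HasAntidiagonal.mem_antidiagonal.1 hp
      have h2 : p.2 ≠ 0 := fun h2 => hpk (Prod.ext (by simp; omega) h2)
      simp [h2]
    · simp

theorem coeff_eq_of_forall_sum_eq {K : Type*} [Field K] [Infinite K] {k l : ℕ} {a b : ℕ → K}
    (h : ∀ t : K, ∑ m ∈ Finset.range k, t ^ m * a m = ∑ m ∈ Finset.range l, t ^ m * b m)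
    {m : ℕ} (hk : m < k) (hl : m < l) : a m = b m := by
  have h1 : ∑ m ∈ Finset.range k, Polynomial.monomial m (a m)
      = ∑ m ∈ Finset.range l, Polynomial.monomial m (b m) := by
    refine Polynomial.funext fun t => ?_
    simpa [Polynomial.eval_finsetSum, mul_comm] using h t
  have h2 := congrArg (fun p => Polynomial.coeff p m) h1
  simpa [Polynomial.finsetSum_coeff, Polynomial.coeff_monomial, hk, hl] using h2

/-- Differentiate the generating function `(1/k) trace (X + t N) ^ k` in direction `Y` and compare
coefficients of `t ^ m`. -/
theorem fderiv_hIntegral_apply {k m : ℕ} (hm : m < k) (X Y : SymMat n) :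
    fderiv ℝ (hIntegral N k m) X Y = trace (wordSum X.mat N (k - 1 - m) m * Y.mat) := by
  refine coeff_eq_of_forall_sum_eq (k := k + 1) (l := k)
    (a := fun m => fderiv ℝ (hIntegral N k m) X Y)
    (b := fun m => trace (wordSum X.mat N (k - 1 - m) m * Y.mat)) (fun t => ?_) (by omega) hm
  have h1 : HasDerivAt (fun s : ℝ => ∑ m ∈ Finset.range (k + 1), t ^ m * hIntegral N k m (X + s • Y))
      (∑ m ∈ Finset.range (k + 1), t ^ m * fderiv ℝ (hIntegral N k m) X Y) 0 := by
    refine HasDerivAt.fun_sum fun m _ => HasDerivAt.const_mul _ ?_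
    have h3 : HasDerivAt (fun s : ℝ => X + s • Y) Y 0 := by
      simpa using ((hasDerivAt_id (0 : ℝ)).smul_const Y).const_add X
    have h4 := ((contDiff_hIntegral N k m).differentiable one_ne_zero (X + (0 : ℝ) • Y)).hasFDerivAt
    have h5 := h4.comp_hasDerivAt (0 : ℝ) h3
    rwa [zero_smul, add_zero] at h5
  have h2 := (hasDerivAt_trace_pow (X.mat + t • N) Y.mat k).const_mul (1 / (k : ℝ))
  have h6 : (fun s : ℝ => ∑ m ∈ Finset.range (k + 1), t ^ m * hIntegral N k m (X + s • Y))
      = fun s : ℝ => 1 / (k : ℝ) * trace ((X.mat + t • N + s • Y.mat) ^ k) := by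
    funext s
    rw [← sum_hIntegral, SymMat.mat_add, SymMat.mat_smul, add_right_comm]
  rw [h6] at h1
  have hk : (k : ℝ) ≠ 0 := by
    have : k ≠ 0 := by omega
    exact_mod_cast this
  rw [h1.unique h2, ← mul_assoc, one_div_mul_cancel hk, one_mul, add_smul_pow_eq_sum_wordSum,
    Finset.sum_mul, trace_sum, Finset.Nat.sum_antidiagonal_eq_sum_range_succ_mk,
    show (k - 1).succ = k by omega, ← Finset.sum_range_reflect]
  refine Finset.sum_congr rfl fun i hi => ?_
  have hi' := Finset.mem_range.1 hi
  rw [smul_mul_assoc, trace_smul, smul_eq_mul, show k - 1 - (k - 1 - i) = i by omega]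

/-- An even number of letters `N` makes the word sum symmetric, so it lies in `SymMat n` and
represents the derivative. -/
theorem mat_gradient_hIntegral (hskew : Nᵀ = -N) {k r : ℕ} (hr : 2 * r < k) (X : SymMat n) :
    (gradient (hIntegral N k (2 * r)) X).mat = wordSum X.mat N (k - 1 - 2 * r) (2 * r) := by
  let G : SymMat n := ⟨wordSum X.mat N (k - 1 - 2 * r) (2 * r), by
    have h := transpose_wordSum X.transpose_mat hskew (k - 1 - 2 * r) (2 * r)
    rwa [pow_mul, neg_one_sq, one_pow, one_mul] at h⟩
  have h : gradient (hIntegral N k (2 * r)) X = G := by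
    refine ext_inner_right ℝ fun Y => ?_
    rw [inner_gradient_left, fderiv_hIntegral_apply N hr, SymMat.inner_eq_trace]
    rfl
  rw [h]
  rfl

theorem isOpen_independenceSet : IsOpen (independenceSet N) := by
  have : Finite (IntegralIndex n) := Finite.of_injective (β := Fin n × Fin n)
    (fun p => (⟨p.1.1, p.2.2.1⟩, ⟨p.1.2, by have := p.2; omega⟩))
    fun p q h => by
      simp only [Prod.mk.injEq, Fin.mk.injEq] at h
      exact Subtype.ext (Prod.ext h.1 h.2)
  refine (isOpen_setOfPred_linearIndependent (𝕜 := ℝ) (E := SymMat n)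
    (ι := IntegralIndex n)).preimage (continuous_pi fun p => ?_)
  exact (InnerProductSpace.toDual ℝ (SymMat n)).symm.continuous.comp
    ((contDiff_hIntegral N _ _).continuous_fderiv one_ne_zero)

end Gradient

/-! ### From one witness to almost every symmetric matrix -/

section Main

variable {n : ℕ} {N : Matrix (Fin n) (Fin n) ℝ}

theorem mem_independenceSet_of_linearIndependent_wordSum (hskew : Nᵀ = -N) {X : SymMat n}
    (h : LinearIndependent ℂ fun p : WordIndex n =>
      wordSum (X.mat.map (algebraMap ℝ ℂ)) (N.map (algebraMap ℝ ℂ)) p.1.1 p.1.2) :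
    X ∈ independenceSet N := by
  let ι : IntegralIndex n → WordIndex n := fun p =>
    ⟨(p.1.1 - 1 - 2 * p.1.2, 2 * p.1.2), by have := p.2; omega⟩
  have hι : Function.Injective ι := by
    intro p q hpq
    have h1 := congrArg (fun x : WordIndex n => x.1.1) hpq
    have h2 := congrArg (fun x : WordIndex n => x.1.2) hpq
    have hp := p.2
    have hq := q.2
    simp only [ι] at h1 h2
    exact Subtype.ext (Prod.ext (by omega) (by omega))
  have hR : LinearIndependent ℝ ((fun p : WordIndex n =>
      wordSum (X.mat.map (algebraMap ℝ ℂ)) (N.map (algebraMap ℝ ℂ)) p.1.1 p.1.2) ∘ ι) :=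
    (h.restrict_scalars (R := ℝ) fun x y hxy => by simpa using hxy).comp ι hι
  let L : SymMat n →ₗ[ℝ] Matrix (Fin n) (Fin n) ℂ :=
    { toFun := fun Y => Y.mat.map (algebraMap ℝ ℂ)
      map_add' := fun Y Z => by ext; simp [SymMat.mat_add]
      map_smul' := fun c Y => by ext; simp [SymMat.mat_smul] }
  refine LinearIndependent.of_comp L ?_
  convert hR using 1
  funext p
  have h1 := mat_gradient_hIntegral N hskew p.2.2.2 X
  refine (congrArg (fun A : Matrix (Fin n) (Fin n) ℝ => A.map (algebraMap ℝ ℂ)) h1).trans ?_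
  exact map_wordSum _ _ (algebraMap ℝ ℂ).mapMatrix _ _

/-- With `A`, `B` the real and imaginary parts of a complex witness, the line `A + t B` meets it at
`t = i`; only finitely many `t` are bad, so some real `t` is good. -/
theorem exists_symMat_linearIndependent_wordSum (hskew : Nᵀ = -N)
    (hdistinct : (N.map (algebraMap ℝ ℂ)).charpoly.roots.Nodup) :
    ∃ X : SymMat n, LinearIndependent ℂ fun p : WordIndex n =>
      wordSum (X.mat.map (algebraMap ℝ ℂ)) (N.map (algebraMap ℝ ℂ)) p.1.1 p.1.2 := by
  obtain ⟨Z, hZ, hLI⟩ := exists_symmetric_linearIndependent_wordSum hskew hdistinct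
  let A : SymMat n := ⟨Z.map Complex.re, by
    ext a b; exact congrArg Complex.re (congrFun (congrFun hZ a) b)⟩
  let B : SymMat n := ⟨Z.map Complex.im, by
    ext a b; exact congrArg Complex.im (congrFun (congrFun hZ a) b)⟩
  have hZAB : Z = A.mat.map (algebraMap ℝ ℂ) + Complex.I • B.mat.map (algebraMap ℝ ℂ) := by
    ext a b
    rw [Matrix.add_apply, Matrix.smul_apply, smul_eq_mul, mul_comm]
    exact (Complex.re_add_im (Z a b)).symm
  rw [hZAB] at hLI
  have hfin := finite_setOf_not_linearIndependent_wordSum _ _ _ (fun p : WordIndex n => p.1) _ hLI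
  obtain ⟨t, ht⟩ := (hfin.preimage (f := ((↑) : ℝ → ℂ)) Complex.ofReal_injective.injOn).exists_notMem
  refine ⟨A + t • B, ?_⟩
  have h1 : (A + t • B).mat.map (algebraMap ℝ ℂ)
      = A.mat.map (algebraMap ℝ ℂ) + (t : ℂ) • B.mat.map (algebraMap ℝ ℂ) := by
    ext a b
    simp [SymMat.mat_add, SymMat.mat_smul]
  rw [h1]
  exact not_not.1 ht

/-- For `t ≠ 0`, `Y + t X = t (X + t⁻¹ Y)`. The line `X + s Y` is good at `s = 0`, and the factor
`t` only rescales each word sum. -/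
theorem ae_add_smul_mem_independenceSet (hskew : Nᵀ = -N) {X : SymMat n}
    (hX : LinearIndependent ℂ fun p : WordIndex n =>
      wordSum (X.mat.map (algebraMap ℝ ℂ)) (N.map (algebraMap ℝ ℂ)) p.1.1 p.1.2) (Y : SymMat n) :
    ∀ᵐ t : ℝ, Y + t • X ∈ independenceSet N := by
  have hX0 : X.mat.map (algebraMap ℝ ℂ) = X.mat.map (algebraMap ℝ ℂ)
      + (0 : ℂ) • Y.mat.map (algebraMap ℝ ℂ) := by simp
  rw [hX0] at hX
  have hfin := finite_setOf_not_linearIndependent_wordSum _ _ _ (fun p : WordIndex n => p.1) _ hX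
  have hfin' := (hfin.preimage (f := fun t : ℝ => ((t⁻¹ : ℝ) : ℂ))
    (Complex.ofReal_injective.comp inv_injective).injOn).insert 0
  rw [MeasureTheory.ae_iff]
  refine (hfin'.subset fun t ht => ?_).measure_zero _
  rw [Set.mem_insert_iff, or_iff_not_imp_left]
  intro ht0 hLI
  refine ht (mem_independenceSet_of_linearIndependent_wordSum hskew ?_)
  have ht0' : (t : ℂ) ≠ 0 := Complex.ofReal_ne_zero.2 ht0
  have h1 : (Y + t • X).mat.map (algebraMap ℝ ℂ) = (t : ℂ) • (X.mat.map (algebraMap ℝ ℂ)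
      + ((t⁻¹ : ℝ) : ℂ) • Y.mat.map (algebraMap ℝ ℂ)) := by
    ext a b
    simp [SymMat.mat_add, SymMat.mat_smul, mul_add, ht0', add_comm]
  simp only [h1, wordSum_smul_left]
  exact hLI.units_smul fun p : WordIndex n => Units.mk0 (t : ℂ) ht0' ^ p.1.1

end Main

theorem mainTheorem2 (n : ℕ) (N : Matrix (Fin n) (Fin n) ℝ)
    (hskew : N.transpose = -N) (hinv : IsUnit N)
    (hdistinct : (N.map (algebraMap ℝ ℂ)).charpoly.roots.Nodup) :
    IsOpen (independenceSet N) ∧ Dense (independenceSet N) ∧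
      MeasureTheory.volume (independenceSet N)ᶜ = 0 := by
  obtain ⟨X, hX⟩ := exists_symMat_linearIndependent_wordSum hskew hdistinct
  have hopen := isOpen_independenceSet N
  -- Fubini over the lines in direction `X`.
  have hae : ∀ᵐ Y : SymMat n, Y ∈ independenceSet N :=
    MeasureTheory.ae_mem_of_ae_add_linearMap_mem (LinearMap.toSpanSingleton ℝ (SymMat n) X)
      MeasureTheory.volume MeasureTheory.volume hopen.measurableSet
      fun Y => ae_add_smul_mem_independenceSet hskew hX Y
  exact ⟨hopen, MeasureTheory.Measure.dense_of_ae hae, MeasureTheory.mem_ae_iff.1 hae⟩
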